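/- Let $(M,g)$ be a smooth (Hausdorff) Riemannian manifold of dimension $n>2$ with Levi-Civita connection $\nabla$, let $\xi$ be a smooth vector field with $g(\xi,\xi)=1$, and let $\pi$ be the $1$-form $\pi(X)=g(X,\xi)$. Assume that $\pi$ is parallel, i.e. $(\nabla_X\pi)(Y)=X(\pi(Y))-\pi(\nabla_XY)=0$ for all vector fields $X,Y$. Let $\tilde\nabla$ be the projective semi-symmetric connection $$\tilde\nabla_XY=\nabla_XY+\psi(Y)X+\psi(X)Y+\phi(Y)X-\phi(X)Y,\qquad \phi=\tfrac12\,\pi,\quad \psi=\tfrac{n-1}{2(n+1)}\,\pi,$$ and let $\tilde R(X,Y)Z=\tilde\nabla_X\tilde\nabla_YZ-\tilde\nabla_Y\tilde\nabla_XZ-\tilde\nabla_{[X,Y]}Z$ be its curvature tensor. Suppose that $(M,g)$ is semi-symmetric with respect to $\tilde\nabla$, i.e. $\tilde R\cdot\tilde R=0$, which means $$\tilde R(X,Y)\tilde R(Z,U)V-\tilde R(\tilde R(X,Y)Z,U)V-\tilde R(Z,\tilde R(X,Y)U)V-\tilde R(Z,U)\tilde R(X,Y)V=0$$ for all vector fields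 $X,Y,Z,U,V$. Then $\tilde R$ is recurrent with respect to $\tilde\nabla$, in the sense that for all vector fields $X,Y,Z,U$, $$(\tilde\nabla_X\tilde R)(Y,Z)U=\rho(X)\,\tilde R(Y,Z)U,\qquad \rho=-\frac{2(n-1)}{n+1}\,\pi,$$ where $(\tilde\nabla_X\tilde R)(Y,Z)U=\tilde\nabla_X(\tilde R(Y,Z)U)-\tilde R(\tilde\nabla_XY,Z)U-\tilde R(Y,\tilde\nabla_XZ)U-\tilde R(Y,Z)\tilde\nabla_XU$. -/

import Mathlib

open Bundle
open scoped Manifold ContDiff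

noncomputable section

namespace ProjSemiSymm

variable {E : Type*} [NormedAddCommGroup E] [NormedSpace ℝ E]
  {M : Type*} [TopologicalSpace M] [ChartedSpace E M] [IsManifold 𝓘(ℝ, E) ∞ M]

/-- A smooth (`C^∞`) vector field on `M`. -/
def IsSmoothField (X : (x : M) → TangentSpace 𝓘(ℝ, E) x) : Prop :=
  ContMDiff 𝓘(ℝ, E) 𝓘(ℝ, E).tangent ∞ (fun x : M => (⟨x, X x⟩ : TangentBundle 𝓘(ℝ, E) M))

/-- The vector field `∇_X Y` of a linear connection `∇`. -/
def nabla (D : CovariantDerivative 𝓘(ℝ, E) E (TangentSpace 𝓘(ℝ, E) : M → Type _))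
    (X Y : (x : M) → TangentSpace 𝓘(ℝ, E) x) : (x : M) → TangentSpace 𝓘(ℝ, E) x :=
  fun x => D Y x (X x)

/-- The curvature tensor of a linear connection,
`R(X, Y) Z = ∇_X ∇_Y Z - ∇_Y ∇_X Z - ∇_[X, Y] Z`. -/
def curvature (D : CovariantDerivative 𝓘(ℝ, E) E (TangentSpace 𝓘(ℝ, E) : M → Type _))
    (X Y Z : (x : M) → TangentSpace 𝓘(ℝ, E) x) : (x : M) → TangentSpace 𝓘(ℝ, E) x :=
  nabla D X (nabla D Y Z) - nabla D Y (nabla D X Z)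
    - nabla D (VectorField.mlieBracket 𝓘(ℝ, E) X Y) Z

/-- The action of the curvature endomorphism `R(X, Y)`, as a derivation, on the curvature tensor:
`(R(X, Y) · R)(Z, U) V =
  R(X, Y) R(Z, U) V - R(R(X, Y) Z, U) V - R(Z, R(X, Y) U) V - R(Z, U) R(X, Y) V`. -/
def curvatureActCurvature
    (D : CovariantDerivative 𝓘(ℝ, E) E (TangentSpace 𝓘(ℝ, E) : M → Type _))
    (X Y Z U V : (x : M) → TangentSpace 𝓘(ℝ, E) x) : (x : M) → TangentSpace 𝓘(ℝ, E) x :=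
  curvature D X Y (curvature D Z U V) - curvature D (curvature D X Y Z) U V
    - curvature D Z (curvature D X Y U) V - curvature D Z U (curvature D X Y V)

/-- `M` is semi-symmetric with respect to the linear connection `D`: `R · R = 0` for the
curvature tensor `R` of `D`. -/
def IsSemiSymmetricFor
    (D : CovariantDerivative 𝓘(ℝ, E) E (TangentSpace 𝓘(ℝ, E) : M → Type _)) : Prop :=
  ∀ X Y Z U V : (x : M) → TangentSpace 𝓘(ℝ, E) x,
    IsSmoothField X → IsSmoothField Y → IsSmoothField Z → IsSmoothField U → IsSmoothField V →
    curvatureActCurvature D X Y Z U V = 0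

/-- The covariant derivative of the curvature tensor of `D` with respect to `D` itself:
`(∇_X R)(Y, Z) U = ∇_X (R(Y, Z) U) - R(∇_X Y, Z) U - R(Y, ∇_X Z) U - R(Y, Z) ∇_X U`. -/
def nablaCurvature (D : CovariantDerivative 𝓘(ℝ, E) E (TangentSpace 𝓘(ℝ, E) : M → Type _))
    (X Y Z U : (x : M) → TangentSpace 𝓘(ℝ, E) x) : (x : M) → TangentSpace 𝓘(ℝ, E) x :=
  nabla D X (curvature D Y Z U) - curvature D (nabla D X Y) Z U
    - curvature D Y (nabla D X Z) U - curvature D Y Z (nabla D X U)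

/-- The curvature tensor of `D` is recurrent with recurrence `1`-form `ρ`:
`(∇_X R)(Y, Z) U = ρ(X) R(Y, Z) U`. -/
def IsRecurrentWith (D : CovariantDerivative 𝓘(ℝ, E) E (TangentSpace 𝓘(ℝ, E) : M → Type _))
    (ρ : (x : M) → TangentSpace 𝓘(ℝ, E) x →L[ℝ] ℝ) : Prop :=
  ∀ X Y Z U : (x : M) → TangentSpace 𝓘(ℝ, E) x,
    IsSmoothField X → IsSmoothField Y → IsSmoothField Z → IsSmoothField U →
    ∀ x : M, nablaCurvature D X Y Z U x = ρ x (X x) • curvature D Y Z U x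

/-- The covariant derivative of the `1`-form `η` vanishes:
`(∇_X η)(Y) = X(η(Y)) - η(∇_X Y) = 0` for all smooth vector fields `X`, `Y`. -/
def IsParallelOneForm
    (D : CovariantDerivative 𝓘(ℝ, E) E (TangentSpace 𝓘(ℝ, E) : M → Type _))
    (η : (x : M) → TangentSpace 𝓘(ℝ, E) x →L[ℝ] ℝ) : Prop :=
  ∀ X Y : (x : M) → TangentSpace 𝓘(ℝ, E) x, IsSmoothField X → IsSmoothField Y →
    ∀ x : M, mvfderiv 𝓘(ℝ, E) (fun y => η y (Y y)) x (X x) - η x (nabla D X Y x) = 0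

/-- For a linear connection `∇` and a `1`-form `η` on an `n`-dimensional manifold, the connection
`∇~_X Y = ∇_X Y + ψ(Y) X + ψ(X) Y + φ(Y) X - φ(X) Y`,
where `φ = (1/2) η` and `ψ = (n - 1) / (2 (n + 1)) η`. -/
def projSemiSymmConnection
    (D : CovariantDerivative 𝓘(ℝ, E) E (TangentSpace 𝓘(ℝ, E) : M → Type _))
    (η : (x : M) → TangentSpace 𝓘(ℝ, E) x →L[ℝ] ℝ) :
    CovariantDerivative 𝓘(ℝ, E) E (TangentSpace 𝓘(ℝ, E) : M → Type _) :=
  let n : ℝ := Module.finrank ℝ E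
  let φ : (x : M) → TangentSpace 𝓘(ℝ, E) x →L[ℝ] ℝ := fun x => (1 / 2 : ℝ) • η x
  let ψ : (x : M) → TangentSpace 𝓘(ℝ, E) x →L[ℝ] ℝ := fun x => ((n - 1) / (2 * (n + 1))) • η x
  { toFun := fun Y x => D Y x
      + ψ x (Y x) • ContinuousLinearMap.id ℝ (TangentSpace 𝓘(ℝ, E) x)
      + (ψ x).smulRight (Y x)
      + φ x (Y x) • ContinuousLinearMap.id ℝ (TangentSpace 𝓘(ℝ, E) x)
      - (φ x).smulRight (Y x)
    isCovariantDerivativeOnUniv :=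
      { add := by
          intro σ σ' x hσ hσ' _
          ext v
          simp [D.isCovariantDerivativeOnUniv.add hσ hσ']
          module
        leibniz := by
          intro σ g x hσ hg _
          ext v
          simp [D.isCovariantDerivativeOnUniv.leibniz hσ hg]
          module } }

theorem nabla_projSemiSymmConnection
    (D : CovariantDerivative 𝓘(ℝ, E) E (TangentSpace 𝓘(ℝ, E) : M → Type _))
    (η : (x : M) → TangentSpace 𝓘(ℝ, E) x →L[ℝ] ℝ)
    (X Y : (x : M) → TangentSpace 𝓘(ℝ, E) x) (x : M) :
    nabla (projSemiSymmConnection D η) X Y x = nabla D X Y x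
      + (((Module.finrank ℝ E : ℝ) - 1) / (2 * ((Module.finrank ℝ E : ℝ) + 1)) * η x (Y x)) • X x
      + (((Module.finrank ℝ E : ℝ) - 1) / (2 * ((Module.finrank ℝ E : ℝ) + 1)) * η x (X x)) • Y x
      + (1 / 2 * η x (Y x)) • X x - (1 / 2 * η x (X x)) • Y x := by
  rfl

/-- The `1`-form `η(X) = g(X, ξ)` metrically dual to the vector field `ξ`. -/
def dualForm
    (g : ContMDiffRiemannianMetric 𝓘(ℝ, E) ∞ E (TangentSpace 𝓘(ℝ, E) : M → Type _))
    (ξ : (x : M) → TangentSpace 𝓘(ℝ, E) x) : (x : M) → TangentSpace 𝓘(ℝ, E) x →L[ℝ] ℝ :=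
  fun x => g.inner x (ξ x)

/-- `D` is the Levi-Civita connection of the Riemannian metric `g`: it is a smooth connection (it
sends smooth fields to smooth fields), it is torsion-free, and it is compatible with the metric,
`X(g(Y, Z)) = g(∇_X Y, Z) + g(Y, ∇_X Z)`. -/
structure IsLeviCivita [FiniteDimensional ℝ E]
    (g : ContMDiffRiemannianMetric 𝓘(ℝ, E) ∞ E (TangentSpace 𝓘(ℝ, E) : M → Type _))
    (D : CovariantDerivative 𝓘(ℝ, E) E (TangentSpace 𝓘(ℝ, E) : M → Type _)) : Prop where
  smooth : CovariantDerivative.ContMDiffCovariantDerivative D ∞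
  torsion_free : D.torsion = 0
  metric : ∀ X Y Z : (x : M) → TangentSpace 𝓘(ℝ, E) x,
    IsSmoothField X → IsSmoothField Y → IsSmoothField Z → ∀ x : M,
    mvfderiv 𝓘(ℝ, E) (fun y => g.inner y (Y y) (Z y)) x (X x)
      = g.inner x (nabla D X Y x) (Z x) + g.inner x (Y x) (nabla D X Z x)

end ProjSemiSymm

end

/-! Write `η = g(ξ, ·)`, `R` and `R'` for the curvatures of `D` and of the modified connection `D'`,
where `D'_X Y = D_X Y + c η(Y) X + d η(X) Y` with `c = n/(n+1)` and `d = -1/(n+1)`. As `η` is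
parallel, hence closed, `R'(X,Y)Z = R(X,Y)Z + c² η(Z)(η(Y)X - η(X)Y)` (`curvature_of_nabla_eq`).

Semi-symmetry forces `R = 0` (`curvature_eq_zero_of_isSemiSymmetricFor`). The parallel field `ξ`
annihilates `R` in every slot, so only arguments orthogonal to `ξ` matter. Let `P` be the projection
to `ξ^⊥`. Then `R'(ξ,Z)` sends `ξ` to `-c² PZ` and kills `ξ^⊥`, so `(R'(ξ,Z)·R')(PX,PY)ξ = c²
R(PX,PY)PZ`.

What remains of `R'` is quadratic in `η`, and `(D'_X η)(Y) = -(c+d) η(X) η(Y)`. Hence `R'` is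
recurrent with form `-2(c+d) η` (`isRecurrentWith_of_curvature_eq`). -/

namespace ProjSemiSymm

/-! ### Smooth fields, connections and metrics: elementary calculus. -/

section Calculus

variable {E : Type*} [NormedAddCommGroup E] [NormedSpace ℝ E]
  {M : Type*} [TopologicalSpace M] [ChartedSpace E M] [IsManifold 𝓘(ℝ, E) ∞ M]
  {X Y Z W : (x : M) → TangentSpace 𝓘(ℝ, E) x} {f : M → ℝ}

lemma IsSmoothField.add (hX : IsSmoothField X) (hY : IsSmoothField Y) : IsSmoothField (X + Y) :=
  ContMDiff.add_section hX hY

lemma IsSmoothField.sub (hX : IsSmoothField X) (hY : IsSmoothField Y) : IsSmoothField (X - Y) :=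
  ContMDiff.sub_section hX hY

lemma IsSmoothField.smul (hf : ContMDiff 𝓘(ℝ, E) 𝓘(ℝ, ℝ) ∞ f) (hX : IsSmoothField X) :
    IsSmoothField (f • X) :=
  ContMDiff.smul_section hf hX

lemma IsSmoothField.const_smul (a : ℝ) (hX : IsSmoothField X) : IsSmoothField (a • X) :=
  ContMDiff.smul_section (f := fun _ ↦ a) contMDiff_const hX

lemma IsSmoothField.mdifferentiableAt (hX : IsSmoothField X) (x : M) :
    MDifferentiableAt 𝓘(ℝ, E) 𝓘(ℝ, E).tangent
      (fun y : M ↦ (⟨y, X y⟩ : TangentBundle 𝓘(ℝ, E) M)) x :=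
  (ContMDiff.contMDiffAt hX).mdifferentiableAt (by simp)

/-- The derivative `X(f)` of a function along a vector field. -/
noncomputable def directionalDeriv (X : (x : M) → TangentSpace 𝓘(ℝ, E) x) (f : M → ℝ) : M → ℝ :=
  fun x ↦ mvfderiv 𝓘(ℝ, E) f x (X x)

section Connection

variable (D : CovariantDerivative 𝓘(ℝ, E) E (TangentSpace 𝓘(ℝ, E) : M → Type _))

lemma nabla_add_right (X : (x : M) → TangentSpace 𝓘(ℝ, E) x)
    (hY : IsSmoothField Y) (hZ : IsSmoothField Z) :
    nabla D X (Y + Z) = nabla D X Y + nabla D X Z := by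
  funext x
  simp [nabla, D.isCovariantDerivativeOnUniv.add (hY.mdifferentiableAt x) (hZ.mdifferentiableAt x)]

lemma nabla_smul_right (X : (x : M) → TangentSpace 𝓘(ℝ, E) x)
    (hf : ContMDiff 𝓘(ℝ, E) 𝓘(ℝ, ℝ) ∞ f) (hY : IsSmoothField Y) :
    nabla D X (f • Y) = f • nabla D X Y + directionalDeriv X f • Y := by
  funext x
  simp [nabla, directionalDeriv, D.isCovariantDerivativeOnUniv.leibniz (hY.mdifferentiableAt x)
    (hf.contMDiffAt.mdifferentiableAt (by simp))]

lemma nabla_sub_right (X : (x : M) → TangentSpace 𝓘(ℝ, E) x)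
    (hY : IsSmoothField Y) (hZ : IsSmoothField Z) :
    nabla D X (Y - Z) = nabla D X Y - nabla D X Z := by
  have h := nabla_add_right D X (hY.sub hZ) hZ
  rw [sub_add_cancel] at h
  rw [h, add_sub_cancel_right]

lemma nabla_const_smul_right (X : (x : M) → TangentSpace 𝓘(ℝ, E) x) (a : ℝ)
    (hY : IsSmoothField Y) : nabla D X (a • Y) = a • nabla D X Y := by
  have h := nabla_smul_right D X (f := fun _ ↦ a) contMDiff_const hY
  have h0 : directionalDeriv X (fun _ ↦ a) = 0 := by
    funext x
    simp [directionalDeriv, mvfderiv_const]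
  rw [h0, zero_smul, add_zero] at h
  exact h

@[simp]
lemma nabla_zero_right (X : (x : M) → TangentSpace 𝓘(ℝ, E) x) : nabla D X 0 = 0 := by
  funext x
  simp [nabla]

@[simp]
lemma nabla_zero_left (Y : (x : M) → TangentSpace 𝓘(ℝ, E) x) : nabla D 0 Y = 0 := by
  funext x
  simp [nabla]

lemma nabla_sub_left (X Y Z : (x : M) → TangentSpace 𝓘(ℝ, E) x) :
    nabla D (X - Y) Z = nabla D X Z - nabla D Y Z := by
  funext x
  simp [nabla]

lemma nabla_neg_left (X Z : (x : M) → TangentSpace 𝓘(ℝ, E) x) :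
    nabla D (-X) Z = - nabla D X Z := by
  funext x
  simp [nabla]

lemma IsSmoothField.nabla {D} (hD : CovariantDerivative.ContMDiffCovariantDerivative
    (D : CovariantDerivative 𝓘(ℝ, E) E (TangentSpace 𝓘(ℝ, E) : M → Type _)) ∞)
    (hX : IsSmoothField X) (hY : IsSmoothField Y) : IsSmoothField (nabla D X Y) := by
  have h := hD.contMDiff.contMDiff (σ := Y) (ContMDiff.contMDiffOn (by simpa using! hY))
  exact ContMDiff.clm_bundle_apply (contMDiffOn_univ.1 h) hX

lemma curvature_swap (X Y Z : (x : M) → TangentSpace 𝓘(ℝ, E) x) :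
    curvature D X Y Z = - curvature D Y X Z := by
  unfold curvature
  rw [VectorField.mlieBracket_swap, nabla_neg_left]
  abel

end Connection

section Metric

variable (g : ContMDiffRiemannianMetric 𝓘(ℝ, E) ∞ E (TangentSpace 𝓘(ℝ, E) : M → Type _))

lemma contMDiff_inner (hX : IsSmoothField X) (hY : IsSmoothField Y) :
    ContMDiff 𝓘(ℝ, E) 𝓘(ℝ, ℝ) ∞ (fun x ↦ g.inner x (X x) (Y x)) := by
  have : ContMDiff 𝓘(ℝ, E) (𝓘(ℝ, E).prod 𝓘(ℝ)) ∞
      (fun m ↦ TotalSpace.mk' ℝ (E := Bundle.Trivial M ℝ) m (g.inner m (X m) (Y m))) := by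
    apply ContMDiff.clm_bundle_apply₂ (F₁ := E) (F₂ := E)
    · exact g.contMDiff
    · exact hX
    · exact hY
  intro x
  have h := this x
  simp only [contMDiffAt_totalSpace] at h
  exact h.2

lemma contMDiff_dualForm (hX : IsSmoothField X) (hY : IsSmoothField Y) :
    ContMDiff 𝓘(ℝ, E) 𝓘(ℝ, ℝ) ∞ (fun x ↦ dualForm g X x (Y x)) :=
  contMDiff_inner g hX hY

lemma eq_zero_of_inner_self {X : (x : M) → TangentSpace 𝓘(ℝ, E) x}
    (h : ∀ x, g.inner x (X x) (X x) = 0) : X = 0 := by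
  funext x
  by_contra hx
  exact (g.pos x (X x) hx).ne' (h x)

end Metric

end Calculus

/-! ### Symmetries of the Levi-Civita curvature. -/

section LeviCivita

open VectorField

variable {E : Type*} [NormedAddCommGroup E] [NormedSpace ℝ E] [FiniteDimensional ℝ E]
  {M : Type*} [TopologicalSpace M] [ChartedSpace E M] [IsManifold 𝓘(ℝ, E) ∞ M]
  {X Y Z W ξ : (x : M) → TangentSpace 𝓘(ℝ, E) x} {f : M → ℝ}
  {g : ContMDiffRiemannianMetric 𝓘(ℝ, E) ∞ E (TangentSpace 𝓘(ℝ, E) : M → Type _)}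
  {D : CovariantDerivative 𝓘(ℝ, E) E (TangentSpace 𝓘(ℝ, E) : M → Type _)}

lemma mlieBracket_smul_right_eq (X : (x : M) → TangentSpace 𝓘(ℝ, E) x)
    (hf : ContMDiff 𝓘(ℝ, E) 𝓘(ℝ, ℝ) ∞ f) (hY : IsSmoothField Y) :
    mlieBracket 𝓘(ℝ, E) X (f • Y) = directionalDeriv X f • Y + f • mlieBracket 𝓘(ℝ, E) X Y := by
  have : CompleteSpace E := FiniteDimensional.complete ℝ E
  funext x
  exact mlieBracket_smul_right (hf.contMDiffAt.mdifferentiableAt (by simp)) (hY.mdifferentiableAt x)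

lemma mlieBracket_add_right_eq (X : (x : M) → TangentSpace 𝓘(ℝ, E) x)
    (hY : IsSmoothField Y) (hZ : IsSmoothField Z) :
    mlieBracket 𝓘(ℝ, E) X (Y + Z) = mlieBracket 𝓘(ℝ, E) X Y + mlieBracket 𝓘(ℝ, E) X Z := by
  have : CompleteSpace E := FiniteDimensional.complete ℝ E
  funext x
  exact mlieBracket_add_right (hY.mdifferentiableAt x) (hZ.mdifferentiableAt x)

lemma jacobi_mlieBracket (hX : IsSmoothField X) (hY : IsSmoothField Y) (hZ : IsSmoothField Z) :
    mlieBracket 𝓘(ℝ, E) X (mlieBracket 𝓘(ℝ, E) Y Z) =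
      mlieBracket 𝓘(ℝ, E) (mlieBracket 𝓘(ℝ, E) X Y) Z
        + mlieBracket 𝓘(ℝ, E) Y (mlieBracket 𝓘(ℝ, E) X Z) := by
  have : CompleteSpace E := FiniteDimensional.complete ℝ E
  have : IsManifold 𝓘(ℝ, E) (minSmoothness ℝ 3) M := by
    rw [minSmoothness_of_isRCLikeNormedField]
    infer_instance
  apply leibniz_identity_mlieBracket <;> rw [minSmoothness_of_isRCLikeNormedField]
  exacts [ContMDiff.of_le hX (by norm_cast), ContMDiff.of_le hY (by norm_cast),
    ContMDiff.of_le hZ (by norm_cast)]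

namespace IsLeviCivita

lemma mlieBracket_eq (hD : IsLeviCivita g D) (hX : IsSmoothField X) (hY : IsSmoothField Y) :
    mlieBracket 𝓘(ℝ, E) X Y = nabla D X Y - nabla D Y X := by
  have : CompleteSpace E := FiniteDimensional.complete ℝ E
  funext x
  exact (D.torsion_eq_zero_iff.1 hD.torsion_free
    (hX.mdifferentiableAt x) (hY.mdifferentiableAt x)).symm

lemma isSmoothField_nabla (hD : IsLeviCivita g D) (hX : IsSmoothField X) (hY : IsSmoothField Y) :
    IsSmoothField (nabla D X Y) :=
  IsSmoothField.nabla hD.smooth hX hY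

lemma isSmoothField_mlieBracket (hD : IsLeviCivita g D) (hX : IsSmoothField X)
    (hY : IsSmoothField Y) : IsSmoothField (mlieBracket 𝓘(ℝ, E) X Y) := by
  rw [hD.mlieBracket_eq hX hY]
  exact (hD.isSmoothField_nabla hX hY).sub (hD.isSmoothField_nabla hY hX)

lemma isSmoothField_curvature (hD : IsLeviCivita g D) (hX : IsSmoothField X)
    (hY : IsSmoothField Y) (hZ : IsSmoothField Z) : IsSmoothField (curvature D X Y Z) :=
  ((hD.isSmoothField_nabla hX (hD.isSmoothField_nabla hY hZ)).sub
    (hD.isSmoothField_nabla hY (hD.isSmoothField_nabla hX hZ))).sub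
    (hD.isSmoothField_nabla (hD.isSmoothField_mlieBracket hX hY) hZ)

/-- The Lie bracket acts on functions as the commutator of the directional derivatives. -/
lemma directionalDeriv_mlieBracket (hD : IsLeviCivita g D) (hX : IsSmoothField X)
    (hY : IsSmoothField Y) (hξ : IsSmoothField ξ) (hne : ∀ x, ξ x ≠ 0)
    (hf : ContMDiff 𝓘(ℝ, E) 𝓘(ℝ, ℝ) ∞ f)
    (hXf : ContMDiff 𝓘(ℝ, E) 𝓘(ℝ, ℝ) ∞ (directionalDeriv X f))
    (hYf : ContMDiff 𝓘(ℝ, E) 𝓘(ℝ, ℝ) ∞ (directionalDeriv Y f)) (x : M) :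
    directionalDeriv (mlieBracket 𝓘(ℝ, E) X Y) f x
      = directionalDeriv X (directionalDeriv Y f) x
        - directionalDeriv Y (directionalDeriv X f) x := by
  have hXξ := hD.isSmoothField_mlieBracket hX hξ
  have hYξ := hD.isSmoothField_mlieBracket hY hξ
  -- Expand the Jacobi identity for `X`, `Y`, `f • ξ`. The terms with brackets of `ξ` cancel by
  -- Jacobi for `X`, `Y`, `ξ`; what is left is the claim times `ξ`, which vanishes nowhere.
  have h := jacobi_mlieBracket hX hY (hξ.smul hf)
  have h0 := jacobi_mlieBracket hX hY hξ
  rw [mlieBracket_smul_right_eq Y hf hξ, mlieBracket_smul_right_eq X hf hξ,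
    mlieBracket_smul_right_eq _ hf hξ,
    mlieBracket_add_right_eq _ (hξ.smul hYf) (hYξ.smul hf),
    mlieBracket_add_right_eq _ (hξ.smul hXf) (hXξ.smul hf),
    mlieBracket_smul_right_eq _ hYf hξ, mlieBracket_smul_right_eq _ hf hYξ,
    mlieBracket_smul_right_eq _ hXf hξ, mlieBracket_smul_right_eq _ hf hXξ, h0] at h
  have hx := congrFun h x
  simp only [Pi.add_apply, Pi.smul_apply'] at hx
  rw [← sub_eq_zero, ← smul_eq_zero_iff_left (hne x)]
  rw [← sub_eq_zero] at hx
  rw [← neg_eq_zero, ← hx]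
  module

/-- Skew-adjointness of the curvature endomorphisms with respect to the metric. -/
lemma inner_curvature (hD : IsLeviCivita g D) (hX : IsSmoothField X) (hY : IsSmoothField Y)
    (hZ : IsSmoothField Z) (hW : IsSmoothField W) (hξ : IsSmoothField ξ) (hne : ∀ x, ξ x ≠ 0)
    (x : M) :
    g.inner x (curvature D X Y Z x) (W x) = - g.inner x (Z x) (curvature D X Y W x) := by
  have metric : ∀ {A B C}, IsSmoothField A → IsSmoothField B → IsSmoothField C →
      directionalDeriv A (fun y ↦ g.inner y (B y) (C y))
        = (fun y ↦ g.inner y (nabla D A B y) (C y)) + fun y ↦ g.inner y (B y) (nabla D A C y) :=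
    fun hA hB hC ↦ funext (hD.metric _ _ _ hA hB hC)
  have addD : ∀ {A : (x : M) → TangentSpace 𝓘(ℝ, E) x} {p q : M → ℝ},
      ContMDiff 𝓘(ℝ, E) 𝓘(ℝ, ℝ) ∞ p → ContMDiff 𝓘(ℝ, E) 𝓘(ℝ, ℝ) ∞ q →
      directionalDeriv A (p + q) = directionalDeriv A p + directionalDeriv A q := by
    intro A p q hp hq
    funext y
    simp [directionalDeriv, mvfderiv_add (hp.contMDiffAt.mdifferentiableAt (by simp))
      (hq.contMDiffAt.mdifferentiableAt (by simp))]
  have hXZ := hD.isSmoothField_nabla hX hZ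
  have hXW := hD.isSmoothField_nabla hX hW
  have hYZ := hD.isSmoothField_nabla hY hZ
  have hYW := hD.isSmoothField_nabla hY hW
  -- Differentiate the function `g(Z, W)` twice: by metric compatibility the mixed terms are
  -- symmetric in `X` and `Y`, so the commutator formula leaves only the curvature terms.
  have h := hD.directionalDeriv_mlieBracket (f := fun y ↦ g.inner y (Z y) (W y)) hX hY hξ hne
    (contMDiff_inner g hZ hW)
    (by rw [metric hX hZ hW]; exact (contMDiff_inner g hXZ hW).add (contMDiff_inner g hZ hXW))
    (by rw [metric hY hZ hW]; exact (contMDiff_inner g hYZ hW).add (contMDiff_inner g hZ hYW)) x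
  rw [metric hX hZ hW, metric hY hZ hW, metric (hD.isSmoothField_mlieBracket hX hY) hZ hW,
    addD (contMDiff_inner g hYZ hW) (contMDiff_inner g hZ hYW),
    addD (contMDiff_inner g hXZ hW) (contMDiff_inner g hZ hXW),
    metric hX hYZ hW, metric hX hZ hYW, metric hY hXZ hW, metric hY hZ hXW] at h
  simp only [curvature, Pi.sub_apply, Pi.add_apply, map_sub, sub_apply] at h ⊢
  linarith

/-- The first Bianchi identity. -/
lemma bianchi (hD : IsLeviCivita g D) (hX : IsSmoothField X) (hY : IsSmoothField Y)
    (hZ : IsSmoothField Z) :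
    curvature D X Y Z + curvature D Y Z X + curvature D Z X Y = 0 := by
  -- By vanishing torsion, the cyclic sum of curvatures regroups into a cyclic sum of double
  -- brackets, which is zero by Jacobi.
  have key : ∀ {A B C}, IsSmoothField A → IsSmoothField B → IsSmoothField C →
      nabla D A (nabla D B C) - nabla D A (nabla D C B) - nabla D (mlieBracket 𝓘(ℝ, E) B C) A
        = mlieBracket 𝓘(ℝ, E) A (mlieBracket 𝓘(ℝ, E) B C) := fun hA hB hC ↦ by
    rw [hD.mlieBracket_eq hA (hD.isSmoothField_mlieBracket hB hC), hD.mlieBracket_eq hB hC,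
      nabla_sub_right D _ (hD.isSmoothField_nabla hB hC) (hD.isSmoothField_nabla hC hB)]
  have h1 := key hX hY hZ
  have h2 := key hY hZ hX
  have h3 := key hZ hX hY
  have hj := jacobi_mlieBracket hX hY hZ
  rw [mlieBracket_swap (V := mlieBracket 𝓘(ℝ, E) X Y)] at hj
  have hs : mlieBracket 𝓘(ℝ, E) Y (mlieBracket 𝓘(ℝ, E) X Z)
      = - mlieBracket 𝓘(ℝ, E) Y (mlieBracket 𝓘(ℝ, E) Z X) := by
    rw [← h2, mlieBracket_swap (V := Z), nabla_neg_left, ← neg_eq_iff_eq_neg]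
    rw [hD.mlieBracket_eq hY (hD.isSmoothField_mlieBracket hX hZ), hD.mlieBracket_eq hX hZ,
      nabla_sub_right D _ (hD.isSmoothField_nabla hX hZ) (hD.isSmoothField_nabla hZ hX)]
    abel
  rw [hs, ← h1, ← h2, ← h3] at hj
  rw [← sub_eq_zero] at hj
  rw [← hj]
  unfold curvature
  abel

/-- A field killed by all curvature endomorphisms is also in the kernel of the curvature tensor
with respect to its first argument. -/
lemma curvature_left_eq_zero (hD : IsLeviCivita g D) (hξ : IsSmoothField ξ) (hne : ∀ x, ξ x ≠ 0)
    (hW : IsSmoothField W)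
    (hker : ∀ X Y, IsSmoothField X → IsSmoothField Y → curvature D X Y W = 0)
    (hY : IsSmoothField Y) (hZ : IsSmoothField Z) : curvature D W Y Z = 0 := by
  -- The trilinear expression `g(R(W,A)B, C)` is symmetric in `A, B` by Bianchi and skew in `B, C`
  -- by metric compatibility, hence zero. It is tested on `C = R(W,Y)Z`.
  have symm : ∀ {A B}, IsSmoothField A → IsSmoothField B →
      curvature D W A B = curvature D W B A := fun {A B} hA hB ↦ by
    have h := hD.bianchi hW hA hB
    rw [hker A B hA hB, curvature_swap D B, add_zero, ← sub_eq_add_neg] at h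
    exact sub_eq_zero.1 h
  apply eq_zero_of_inner_self g
  intro x
  set V := curvature D W Y Z with hV_def
  have hV : IsSmoothField V := hD.isSmoothField_curvature hW hY hZ
  have skew : ∀ {A B C}, IsSmoothField A → IsSmoothField B → IsSmoothField C →
      g.inner x (curvature D W A B x) (C x) = - g.inner x (curvature D W A C x) (B x) :=
    fun hA hB hC ↦ by rw [hD.inner_curvature hW hA hB hC hξ hne, g.symm]
  have h1 := skew hZ hY hV
  have h2 := skew hV hZ hY
  have h3 := skew hY hV hZ
  rw [symm hZ hY] at h1
  rw [symm hV hZ] at h2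
  rw [symm hY hV] at h3
  rw [← hV_def] at h1 h3
  linarith

end IsLeviCivita

end LeviCivita

/-! ### Curvature in the presence of a parallel one-form. -/

section Parallel

open VectorField

variable {E : Type*} [NormedAddCommGroup E] [NormedSpace ℝ E] [FiniteDimensional ℝ E]
  {M : Type*} [TopologicalSpace M] [ChartedSpace E M] [IsManifold 𝓘(ℝ, E) ∞ M]
  {X Y Z W ξ : (x : M) → TangentSpace 𝓘(ℝ, E) x} {f : M → ℝ}
  {g : ContMDiffRiemannianMetric 𝓘(ℝ, E) ∞ E (TangentSpace 𝓘(ℝ, E) : M → Type _)}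
  {D : CovariantDerivative 𝓘(ℝ, E) E (TangentSpace 𝓘(ℝ, E) : M → Type _)}

omit [FiniteDimensional ℝ E] in
lemma directionalDeriv_parallel {η : (x : M) → TangentSpace 𝓘(ℝ, E) x →L[ℝ] ℝ}
    (hη : IsParallelOneForm D η) (hX : IsSmoothField X) (hY : IsSmoothField Y) :
    directionalDeriv X (fun x ↦ η x (Y x)) = fun x ↦ η x (nabla D X Y x) :=
  funext fun x ↦ sub_eq_zero.1 (hη X Y hX hY x)

namespace IsLeviCivita

/-- Comparing parallelism of the dual form with metric compatibility gives `g(D_X ξ, V) = 0` for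
every smooth `V`; take `V = D_X ξ`. -/
lemma nabla_eq_zero_of_parallel (hD : IsLeviCivita g D) (hξ : IsSmoothField ξ)
    (hpar : IsParallelOneForm D (dualForm g ξ)) (hX : IsSmoothField X) : nabla D X ξ = 0 := by
  have hV := hD.isSmoothField_nabla hX hξ
  apply eq_zero_of_inner_self g
  intro x
  have h := hpar X (nabla D X ξ) hX hV x
  have h' := hD.metric X ξ (nabla D X ξ) hX hξ hV x
  simp only [dualForm] at h
  linarith

/-- Since `D_A (f ξ) = A(f) ξ`, the curvature of `f ξ` is `(XYf - YXf - [X,Y]f) ξ`. For `f = η(Z)`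
the first derivatives `η(D_A Z)` are again smooth, so the commutator formula applies. -/
lemma curvature_smul_eq_zero_of_parallel (hD : IsLeviCivita g D) (hξ : IsSmoothField ξ)
    (hpar : IsParallelOneForm D (dualForm g ξ)) (hne : ∀ x, ξ x ≠ 0)
    (hX : IsSmoothField X) (hY : IsSmoothField Y) (hZ : IsSmoothField Z) :
    curvature D X Y ((fun x ↦ dualForm g ξ x (Z x)) • ξ) = 0 := by
  have hη : ∀ {A}, IsSmoothField A → ContMDiff 𝓘(ℝ, E) 𝓘(ℝ, ℝ) ∞ (fun x ↦ dualForm g ξ x (A x)) :=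
    fun hA ↦ contMDiff_dualForm g hξ hA
  have hnab : ∀ {A B}, IsSmoothField A → IsSmoothField B →
      nabla D A ((fun x ↦ dualForm g ξ x (B x)) • ξ)
        = directionalDeriv A (fun x ↦ dualForm g ξ x (B x)) • ξ := fun hA hB ↦ by
    rw [nabla_smul_right D _ (hη hB) hξ, hD.nabla_eq_zero_of_parallel hξ hpar hA, smul_zero,
      zero_add]
  have hXZ := hD.isSmoothField_nabla hX hZ
  have hYZ := hD.isSmoothField_nabla hY hZ
  have hXY := hD.isSmoothField_mlieBracket hX hY
  have hcomm := funext <| hD.directionalDeriv_mlieBracket hX hY hξ hne (hη hZ)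
    (by rw [directionalDeriv_parallel hpar hX hZ]; exact hη hXZ)
    (by rw [directionalDeriv_parallel hpar hY hZ]; exact hη hYZ)
  rw [curvature, hnab hX hZ, hnab hY hZ, hnab hXY hZ, hcomm,
    directionalDeriv_parallel hpar hX hZ, directionalDeriv_parallel hpar hY hZ,
    hnab hX hYZ, hnab hY hXZ]
  funext x
  simp only [Pi.sub_apply, Pi.smul_apply', Pi.zero_apply]
  module

lemma curvature_sub_right (hD : IsLeviCivita g D) (hX : IsSmoothField X) (hY : IsSmoothField Y)
    (hZ : IsSmoothField Z) (hW : IsSmoothField W) :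
    curvature D X Y (Z - W) = curvature D X Y Z - curvature D X Y W := by
  unfold curvature
  rw [nabla_sub_right D _ hZ hW, nabla_sub_right D _ hZ hW, nabla_sub_right D _ hZ hW,
    nabla_sub_right D _ (hD.isSmoothField_nabla hY hZ) (hD.isSmoothField_nabla hY hW),
    nabla_sub_right D _ (hD.isSmoothField_nabla hX hZ) (hD.isSmoothField_nabla hX hW)]
  abel

lemma curvature_const_smul_right (hD : IsLeviCivita g D) (hX : IsSmoothField X)
    (hY : IsSmoothField Y) (hZ : IsSmoothField Z) {a : ℝ} :
    curvature D X Y (a • Z) = a • curvature D X Y Z := by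
  unfold curvature
  simp only [nabla_const_smul_right D _ a hZ,
    nabla_const_smul_right D _ a (hD.isSmoothField_nabla hY hZ),
    nabla_const_smul_right D _ a (hD.isSmoothField_nabla hX hZ), smul_sub]

lemma curvature_sub_left (hD : IsLeviCivita g D) (hX : IsSmoothField X) (hY : IsSmoothField Y)
    (hZ : IsSmoothField Z) (hW : IsSmoothField W) :
    curvature D (X - Y) Z W = curvature D X Z W - curvature D Y Z W := by
  unfold curvature
  rw [hD.mlieBracket_eq (hX.sub hY) hZ, hD.mlieBracket_eq hX hZ, hD.mlieBracket_eq hY hZ,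
    nabla_sub_right D _ hX hY]
  simp only [nabla_sub_left]
  rw [nabla_sub_right D _ (hD.isSmoothField_nabla hX hW) (hD.isSmoothField_nabla hY hW)]
  abel

end IsLeviCivita

end Parallel

/-! ### The modified connection: curvature, flatness of `D`, recurrence. -/

section SemiSymmetric

open VectorField

variable {E : Type*} [NormedAddCommGroup E] [NormedSpace ℝ E] [FiniteDimensional ℝ E]
  {M : Type*} [TopologicalSpace M] [ChartedSpace E M] [IsManifold 𝓘(ℝ, E) ∞ M]
  {X Y Z W ξ : (x : M) → TangentSpace 𝓘(ℝ, E) x}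
  {g : ContMDiffRiemannianMetric 𝓘(ℝ, E) ∞ E (TangentSpace 𝓘(ℝ, E) : M → Type _)}
  {D D' : CovariantDerivative 𝓘(ℝ, E) E (TangentSpace 𝓘(ℝ, E) : M → Type _)}
  {η : (x : M) → TangentSpace 𝓘(ℝ, E) x →L[ℝ] ℝ} {c d : ℝ}

omit [FiniteDimensional ℝ E] in
lemma nabla_projSemiSymmConnection_eq
    (D : CovariantDerivative 𝓘(ℝ, E) E (TangentSpace 𝓘(ℝ, E) : M → Type _))
    (η : (x : M) → TangentSpace 𝓘(ℝ, E) x →L[ℝ] ℝ) (X Y : (x : M) → TangentSpace 𝓘(ℝ, E) x) :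
    nabla (projSemiSymmConnection D η) X Y = nabla D X Y
      + ((Module.finrank ℝ E : ℝ) / ((Module.finrank ℝ E : ℝ) + 1)) •
          ((fun x ↦ η x (Y x)) • X)
      + (-1 / ((Module.finrank ℝ E : ℝ) + 1)) • ((fun x ↦ η x (X x)) • Y) := by
  have hn : (Module.finrank ℝ E : ℝ) + 1 ≠ 0 := by positivity
  funext x
  rw [nabla_projSemiSymmConnection]
  simp only [Pi.add_apply, Pi.smul_apply, Pi.smul_apply']
  match_scalars
  · ring
  · field_simp
    ring
  · field_simp
    ring

/-- The curvature of the connection `D' = D + c (η(Y) X) + d (η(X) Y)`, for a `D`-parallel `η`. -/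
lemma curvature_of_nabla_eq (hD : IsLeviCivita g D) (hpar : IsParallelOneForm D η)
    (hη : ∀ A, IsSmoothField A → ContMDiff 𝓘(ℝ, E) 𝓘(ℝ, ℝ) ∞ (fun x ↦ η x (A x)))
    (hD' : ∀ X Y, nabla D' X Y = nabla D X Y
      + c • ((fun x ↦ η x (Y x)) • X) + d • ((fun x ↦ η x (X x)) • Y))
    (hX : IsSmoothField X) (hY : IsSmoothField Y) (hZ : IsSmoothField Z) :
    curvature D' X Y Z = curvature D X Y Z
      + c ^ 2 • ((fun x ↦ η x (Z x)) •
          ((fun x ↦ η x (Y x)) • X - (fun x ↦ η x (X x)) • Y)) := by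
  have second : ∀ {A B}, IsSmoothField A → IsSmoothField B →
      nabla D A (nabla D' B Z) = nabla D A (nabla D B Z)
        + c • ((fun x ↦ η x (Z x)) • nabla D A B + (fun x ↦ η x (nabla D A Z x)) • B)
        + d • ((fun x ↦ η x (B x)) • nabla D A Z + (fun x ↦ η x (nabla D A B x)) • Z) := by
    intro A B hA hB
    have hBZ := hD.isSmoothField_nabla hB hZ
    have h1 := (hB.smul (hη Z hZ))
    have h2 := (hZ.smul (hη B hB))
    rw [hD', nabla_add_right D A (hBZ.add (h1.const_smul c)) (h2.const_smul d),
      nabla_add_right D A hBZ (h1.const_smul c), nabla_const_smul_right D A c h1,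
      nabla_const_smul_right D A d h2, nabla_smul_right D A (hη Z hZ) hB,
      nabla_smul_right D A (hη B hB) hZ, directionalDeriv_parallel hpar hA hZ,
      directionalDeriv_parallel hpar hA hB]
  -- After expansion the `c d` terms cancel on antisymmetrizing in `X, Y`. The terms with `η(D_X Y)
  -- - η(D_Y X) - η([X,Y])` vanish because the torsion does.
  rw [curvature, hD' X (nabla D' Y Z), hD' Y (nabla D' X Z), second hX hY, second hY hX,
    hD' (mlieBracket 𝓘(ℝ, E) X Y) Z, hD' Y Z, hD' X Z, curvature, hD.mlieBracket_eq hX hY]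
  funext x
  simp only [Pi.sub_apply, Pi.add_apply, Pi.smul_apply, Pi.smul_apply', map_add, map_sub, map_smul,
    smul_eq_mul]
  module

/-- Recurrence of the curvature tensor `c² η(Z) (η(Y) X - η(X) Y)`. -/
lemma isRecurrentWith_of_curvature_eq (hD : IsLeviCivita g D) (hpar : IsParallelOneForm D η)
    (hη : ∀ A, IsSmoothField A → ContMDiff 𝓘(ℝ, E) 𝓘(ℝ, ℝ) ∞ (fun x ↦ η x (A x)))
    (hD' : ∀ X Y, nabla D' X Y = nabla D X Y
      + c • ((fun x ↦ η x (Y x)) • X) + d • ((fun x ↦ η x (X x)) • Y))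
    (hR : ∀ X Y Z, IsSmoothField X → IsSmoothField Y → IsSmoothField Z →
      curvature D' X Y Z = c ^ 2 • ((fun x ↦ η x (Z x)) •
          ((fun x ↦ η x (Y x)) • X - (fun x ↦ η x (X x)) • Y))) :
    IsRecurrentWith D' (fun x ↦ (-(2 * (c + d))) • η x) := by
  intro X Y Z U hX hY hZ hU x
  have hnab : ∀ {A B}, IsSmoothField A → IsSmoothField B → IsSmoothField (nabla D' A B) := by
    intro A B hA hB
    rw [hD']
    exact ((hD.isSmoothField_nabla hA hB).add ((hA.smul (hη B hB)).const_smul c)).add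
      ((hB.smul (hη A hA)).const_smul d)
  have h1 := hY.smul (hη Z hZ)
  have h2 := hZ.smul (hη Y hY)
  -- Each of the two factors `η` in the curvature contributes `-(c + d) η(X)`, and the identity
  -- endomorphism is parallel.
  rw [nablaCurvature, hR Y Z U hY hZ hU, hR _ Z U (hnab hX hY) hZ hU,
    hR Y _ U hY (hnab hX hZ) hU, hR Y Z _ hY hZ (hnab hX hU), hD' X Y, hD' X Z, hD' X U, hD',
    nabla_const_smul_right D X _ ((h1.sub h2).smul (hη U hU)),
    nabla_smul_right D X (hη U hU) (h1.sub h2), nabla_sub_right D X h1 h2,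
    nabla_smul_right D X (hη Z hZ) hY, nabla_smul_right D X (hη Y hY) hZ,
    directionalDeriv_parallel hpar hX hU, directionalDeriv_parallel hpar hX hZ,
    directionalDeriv_parallel hpar hX hY]
  simp only [Pi.sub_apply, Pi.add_apply, Pi.smul_apply, Pi.smul_apply', map_add, map_sub, map_smul,
    smul_eq_mul, smul_apply]
  module

/-- If `D + c (η(Y) X) + d (η(X) Y)` is semi-symmetric, `c ≠ 0`, and `η` is the parallel form dual
to a unit field, then the Levi-Civita connection `D` is flat. -/
lemma curvature_eq_zero_of_isSemiSymmetricFor (hD : IsLeviCivita g D) (hξ : IsSmoothField ξ)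
    (hunit : ∀ x, g.inner x (ξ x) (ξ x) = 1) (hpar : IsParallelOneForm D (dualForm g ξ))
    (hc : c ≠ 0)
    (hD' : ∀ X Y, nabla D' X Y = nabla D X Y
      + c • ((fun x ↦ dualForm g ξ x (Y x)) • X) + d • ((fun x ↦ dualForm g ξ x (X x)) • Y))
    (hsemi : IsSemiSymmetricFor D')
    (hX : IsSmoothField X) (hY : IsSmoothField Y) (hZ : IsSmoothField Z) :
    curvature D X Y Z = 0 := by
  set η := dualForm g ξ with hη_def
  have hη : ∀ A, IsSmoothField A → ContMDiff 𝓘(ℝ, E) 𝓘(ℝ, ℝ) ∞ (fun x ↦ η x (A x)) :=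
    fun A hA ↦ contMDiff_dualForm g hξ hA
  have hne : ∀ x, ξ x ≠ 0 := fun x h ↦ by simpa [h] using hunit x
  have hR' : ∀ {A B C}, IsSmoothField A → IsSmoothField B → IsSmoothField C →
      curvature D' A B C = curvature D A B C + c ^ 2 • ((fun x ↦ η x (C x)) •
          ((fun x ↦ η x (B x)) • A - (fun x ↦ η x (A x)) • B)) :=
    fun hA hB hC ↦ curvature_of_nabla_eq hD hpar hη hD' hA hB hC
  have hpξ : ∀ {A}, IsSmoothField A → IsSmoothField ((fun x ↦ η x (A x)) • ξ) :=
    fun {A} hA ↦ hξ.smul (hη A hA)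
  have hker : ∀ {A}, IsSmoothField A → ∀ B C, IsSmoothField B → IsSmoothField C →
      curvature D B C ((fun x ↦ η x (A x)) • ξ) = 0 :=
    fun hA B C hB hC ↦ hD.curvature_smul_eq_zero_of_parallel hξ hpar hne hB hC hA
  have hηξ : (fun x ↦ η x (ξ x)) = 1 := funext hunit
  have hkerξ : ∀ B C, IsSmoothField B → IsSmoothField C → curvature D B C ξ = 0 := by
    intro B C hB hC
    have h := hker hξ B C hB hC
    rwa [hηξ, one_smul] at h
  -- the projection to the orthogonal complement of `ξ`
  have hP : ∀ {A}, IsSmoothField A → IsSmoothField (A - (fun x ↦ η x (A x)) • ξ) :=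
    fun hA ↦ hA.sub (hpξ hA)
  have hηP : ∀ A : (x : M) → TangentSpace 𝓘(ℝ, E) x,
      (fun x ↦ η x ((A - (fun x ↦ η x (A x)) • ξ) x)) = 0 := fun A ↦ by
    funext x
    have := hunit x
    simp [hη_def, dualForm, this]
  have curv_zero : ∀ A B : (x : M) → TangentSpace 𝓘(ℝ, E) x,
      curvature D' A B 0 = 0 ∧ curvature D' A 0 B = 0 ∧ curvature D' 0 A B = 0 := fun A B ↦ by
    simp [curvature]
  have hflat : curvature D (X - (fun x ↦ η x (X x)) • ξ) (Y - (fun x ↦ η x (Y x)) • ξ)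
      (Z - (fun x ↦ η x (Z x)) • ξ) = 0 := by
    have hact : ∀ {A}, IsSmoothField A → curvature D' ξ Z A
        = (-c ^ 2) • ((fun x ↦ η x (A x)) • (Z - (fun x ↦ η x (Z x)) • ξ)) := fun {A} hA ↦ by
      rw [hR' hξ hZ hA, hD.curvature_left_eq_zero hξ hne hξ hkerξ hZ hA, hηξ, zero_add, one_smul]
      funext x
      simp only [Pi.sub_apply, Pi.smul_apply, Pi.smul_apply']
      module
    -- Of the four terms only the last survives: `R'(PX,PY)ξ = 0`, and `R'(ξ,Z)` kills `PX` and
    -- `PY`. On `PX`, `PY`, `PZ` the correction to `R` vanishes.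
    have h := hsemi ξ Z (X - (fun x ↦ η x (X x)) • ξ) (Y - (fun x ↦ η x (Y x)) • ξ) ξ hξ hZ
      (hP hX) (hP hY) hξ
    rw [curvatureActCurvature, hR' (hP hX) (hP hY) hξ, hkerξ _ _ (hP hX) (hP hY), hact (hP hX),
      hact (hP hY), hact hξ, hηP, hηP, hηξ] at h
    simp only [zero_smul, one_smul, smul_zero, sub_zero, zero_add, curv_zero, zero_sub] at h
    rw [neg_eq_zero, hR' (hP hX) (hP hY) ((hP hZ).const_smul _), hηP, hηP,
      hD.curvature_const_smul_right (hP hX) (hP hY) (hP hZ)] at h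
    simpa [hc] using h
  -- The projections are removed one slot at a time, since multiples `η(A) ξ` contribute nothing in
  -- any slot.
  have e1 := hD.curvature_sub_right (hP hX) (hP hY) hZ (hpξ hZ)
  rw [hflat, hker hZ _ _ (hP hX) (hP hY), sub_zero] at e1
  have e2 := hD.curvature_sub_left hX (hpξ hX) (hP hY) hZ
  rw [← e1, hD.curvature_left_eq_zero hξ hne (hpξ hX) (hker hX) (hP hY) hZ, sub_zero,
    curvature_swap] at e2
  have e3 := hD.curvature_sub_left hY (hpξ hY) hX hZ
  rw [hD.curvature_left_eq_zero hξ hne (hpξ hY) (hker hY) hX hZ, sub_zero] at e3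
  rw [curvature_swap, ← e3, ← e2]

end SemiSymmetric

end ProjSemiSymm

open ProjSemiSymm in
theorem corollary4p3
    {E : Type*} [NormedAddCommGroup E] [NormedSpace ℝ E] [FiniteDimensional ℝ E]
    {M : Type*} [TopologicalSpace M] [T2Space M] [ChartedSpace E M] [IsManifold 𝓘(ℝ, E) ∞ M]
    (g : ContMDiffRiemannianMetric 𝓘(ℝ, E) ∞ E (TangentSpace 𝓘(ℝ, E) : M → Type _))
    (n : ℕ) (hdim : Module.finrank ℝ E = n) (hn : 2 < n)
    (D : CovariantDerivative 𝓘(ℝ, E) E (TangentSpace 𝓘(ℝ, E) : M → Type _))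
    (hD : IsLeviCivita g D)
    (ξ : (x : M) → TangentSpace 𝓘(ℝ, E) x) (hξ : IsSmoothField ξ)
    (hunit : ∀ x : M, g.inner x (ξ x) (ξ x) = 1)
    (hparallel : IsParallelOneForm D (dualForm g ξ))
    (hsemi : IsSemiSymmetricFor (projSemiSymmConnection D (dualForm g ξ))) :
    IsRecurrentWith (projSemiSymmConnection D (dualForm g ξ))
      (fun x => (-(2 * ((n : ℝ) - 1) / ((n : ℝ) + 1))) • dualForm g ξ x) := by
  have hn1 : (n : ℝ) + 1 ≠ 0 := by positivity
  have hc : (n : ℝ) / (n + 1) ≠ 0 := div_ne_zero (by positivity) hn1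
  have hη : ∀ A, IsSmoothField A →
      ContMDiff 𝓘(ℝ, E) 𝓘(ℝ, ℝ) ∞ (fun x ↦ dualForm g ξ x (A x)) :=
    fun A hA ↦ contMDiff_dualForm g hξ hA
  have hD' := nabla_projSemiSymmConnection_eq D (dualForm g ξ)
  rw [hdim] at hD'
  have h := isRecurrentWith_of_curvature_eq hD hparallel hη hD' fun X Y Z hX hY hZ ↦ by
    rw [curvature_of_nabla_eq hD hparallel hη hD' hX hY hZ,
      curvature_eq_zero_of_isSemiSymmetricFor hD hξ hunit hparallel hc hD' hsemi hX hY hZ, zero_add]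
  -- Here `c + d = (n - 1)/(n + 1)`.
  have hcd : -(2 * ((n : ℝ) - 1) / (n + 1)) = -(2 * ((n : ℝ) / (n + 1) + -1 / (n + 1))) := by
    field_simp
    ring
  rwa [hcd]
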